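/- A class of groups $\mathcal{C}$ (closed under isomorphism) is called a root class if it contains a non-trivial group and is closed under taking subgroups, extensions, and Cartesian powers $\prod_{y \in Y} X_y$ with $X, Y \in \mathcal{C}$ and $X_y \cong X$ for every $y \in Y$. A group $X$ is residually a $\mathcal{C}$-group if for every $x \in X \setminus \{1\}$ there is a homomorphism $\sigma$ of $X$ onto a group from $\mathcal{C}$ with $x\sigma \neq 1$. A graph of groups $\mathcal{G}(\Gamma) = (\Gamma, G_v\ (v \in \mathcal{V}), H_e, \varphi_{\pm e}\ (e \in \mathcal{E}))$ over a non-empty connected undirected graph $\Gamma = (\mathcal{V}, \mathcal{E})$ (loops and multiple edges are allowed) assigns to each vertex $v$ a group $G_v$, and to each edge $e$ a direction, i.e. an ordering $e(1), e(-1)$ of its ends, a group $H_e$ and injective homomorphisms $\varphi_{\varepsilon e} : H_e \to G_{e(\varepsilon)}$ ($\varepsilon = \pm 1$); the subgroups $H_{\varepsilon e} = H_e\varphi_{\varepsilon e}$ are its edge subgroups. If $\mathcal{T} = (\mathcal{V}, \mathcal{E}_{\mathcal{T}})$ is a maximal tree in $\Gamma$, the fundamental group $\pi_1(\mathcal{G}(\Gamma),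 \mathcal{T})$ is generated by the groups $G_v$ ($v \in \mathcal{V}$) and symbols $t_e$ ($e \in \mathcal{E} \setminus \mathcal{E}_{\mathcal{T}}$), subject to the relations of the groups $G_v$ and the relations $h\varphi_{+e} = h\varphi_{-e}$ ($e \in \mathcal{E}_{\mathcal{T}}$, $h \in H_e$) and $t_e^{-1}(h\varphi_{+e})t_e = h\varphi_{-e}$ ($e \in \mathcal{E} \setminus \mathcal{E}_{\mathcal{T}}$, $h \in H_e$). Up to isomorphism it does not depend on $\mathcal{T}$ and is then denoted by $\pi_1(\mathcal{G}(\Gamma))$; the groups $G_v$ are identified with their images in it. **Theorem 3.** Let $\mathcal{C}$ be a root class of groups that consists of periodic groups and contains at least one infinite group. Then for any non-empty connected undirected graph $\Gamma = (\mathcal{V}, \mathcal{E})$ with a non-empty set of edges there exists a graph of groups $\mathcal{G}(\Gamma) = (\Gamma, G_v\ (v \in \mathcal{V}), H_e, \varphi_{\pm e}\ (e \in \mathcal{E}))$ such that: 1) all groups $G_v$ ($v \in \mathcal{V}$) belong to $\mathcal{C}$; 2) all subgroups $H_{\varepsilon e}$ ($e \in \mathcal{E}$, $\varepsilon = \pm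 1$) are non-trivial; 3) $\pi_1(\mathcal{G}(\Gamma))$ is residually a $\mathcal{C}$-group; 4) if $\mathcal{T}$ is a maximal tree in $\Gamma$ and $\sigma$ is a homomorphism of $\pi_1(\mathcal{G}(\Gamma), \mathcal{T})$ onto a group from $\mathcal{C}$, then $\ker \sigma \cap H_{\varepsilon e} \neq 1$ for any $e \in \mathcal{E}$, $\varepsilon = \pm 1$. -/

import Mathlib

universe u v w

/-- `C` is a root class of groups: an (isomorphism-closed) class of groups that contains a
non-trivial group and is closed under taking subgroups, extensions, and Cartesian powers
`∏_{y ∈ Y} X_y` with `X, Y ∈ C` and every `X_y` a copy of `X`. -/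
structure IsRootClass (C : ∀ (G : Type u) [Group G], Prop) : Prop where
  of_mulEquiv : ∀ (G H : Type u) [Group G] [Group H], (G ≃* H) → C G → C H
  exists_nontrivial : ∃ (G : Type u) (_ : Group G), C G ∧ Nontrivial G
  subgroup : ∀ (G : Type u) [Group G], C G → ∀ K : Subgroup G, C K
  extension : ∀ (G : Type u) [Group G] (N : Subgroup G) [N.Normal], C N → C (G ⧸ N) → C G
  power : ∀ (X Y : Type u) [Group X] [Group Y], C X → C Y → C (Y → X)

/-- `X` is residually a `C`-group: every non-trivial element of `X` survives in some homomorphism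
of `X` onto a `C`-group. -/
def IsResidually (C : ∀ (G : Type u) [Group G], Prop) (X : Type v) [Group X] : Prop :=
  ∀ x : X, x ≠ 1 → ∃ (Q : Type u) (_ : Group Q) (σ : X →* Q),
    C Q ∧ Function.Surjective σ ∧ σ x ≠ 1

namespace Graph

variable {α : Type v} {β : Type w}

/-- An undirected graph (with loops and multiple edges allowed) is connected if it is non-empty
and any two vertices are joined by a path. -/
def IsConnected (Γ : Graph α β) : Prop :=
  Γ.toSimpleGraph.Connected

/-- `T` is a maximal tree in `Γ`: a subgraph that is a tree (in particular without loops and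
multiple edges) and contains all vertices of `Γ`. -/
structure IsMaximalTree (T Γ : Graph α β) : Prop where
  spanning : T ≤s Γ
  simple : T.Simple
  isTree : T.toSimpleGraph.IsTree

end Graph

/-- A directed graph of groups over an undirected graph `Γ`. The Boolean `true` stands for the
sign `+1` and `false` for the sign `-1`; `e(ε)` is `endpt e ε`, so that `endpt` chooses a direction
of each edge. -/
structure GraphOfGroups {α : Type v} {β : Type w} (Γ : Graph α β) where
  vertexGroup : Γ.vertexSet → Type u
  [groupVertex : ∀ x, Group (vertexGroup x)]
  endpt : Γ.edgeSet → Bool → Γ.vertexSet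
  isLink_endpt : ∀ e : Γ.edgeSet, Γ.IsLink (e : β) (endpt e true) (endpt e false)
  edgeGroup : Γ.edgeSet → Type u
  [groupEdge : ∀ e, Group (edgeGroup e)]
  φ : ∀ (e : Γ.edgeSet) (ε : Bool), edgeGroup e →* vertexGroup (endpt e ε)
  φ_injective : ∀ e ε, Function.Injective (φ e ε)

namespace GraphOfGroups

variable {α : Type v} {β : Type w} {Γ : Graph α β}

attribute [instance] GraphOfGroups.groupVertex GraphOfGroups.groupEdge

variable (𝒢 : GraphOfGroups.{u} Γ) (T : Graph α β)

/-- The edge subgroup `H_{εe}` of the vertex group `G_{e(ε)}`. -/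
def edgeSubgroup (e : Γ.edgeSet) (ε : Bool) : Subgroup (𝒢.vertexGroup (𝒢.endpt e ε)) :=
  (𝒢.φ e ε).range

/-- The edges of `Γ` outside `T`; they index the symbols `t_e`. -/
abbrev StableEdge (Γ T : Graph α β) : Type w :=
  {e : Γ.edgeSet // (e : β) ∉ T.edgeSet}

/-- The group with the generators and relations of all vertex groups, the additional generators
`t_e` for the edges outside `T`, and no further relations. -/
abbrev PreFundamentalGroup : Type (max u v w) :=
  Monoid.Coprod (Monoid.CoprodI 𝒢.vertexGroup) (FreeGroup (StableEdge Γ T))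

/-- The canonical image of a vertex group in `PreFundamentalGroup`. -/
def preOf (x : Γ.vertexSet) : 𝒢.vertexGroup x →* 𝒢.PreFundamentalGroup T :=
  Monoid.Coprod.inl.comp Monoid.CoprodI.of

/-- The generator `t_e` in `PreFundamentalGroup`. -/
def preT (e : StableEdge Γ T) : 𝒢.PreFundamentalGroup T :=
  Monoid.Coprod.inr (FreeGroup.of e)

/-- The relators of the fundamental group that come from the edges:
`φ_{+e}(h) = φ_{-e}(h)` for the edges of `T` and
`t_e⁻¹ φ_{+e}(h) t_e = φ_{-e}(h)` for the other edges. -/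
inductive IsRelator : 𝒢.PreFundamentalGroup T → Prop
  | tree (e : Γ.edgeSet) (he : (e : β) ∈ T.edgeSet) (h : 𝒢.edgeGroup e) :
      IsRelator (𝒢.preOf T _ (𝒢.φ e true h) * (𝒢.preOf T _ (𝒢.φ e false h))⁻¹)
  | stable (e : StableEdge Γ T) (h : 𝒢.edgeGroup e.1) :
      IsRelator ((𝒢.preT T e)⁻¹ * 𝒢.preOf T _ (𝒢.φ e.1 true h) * 𝒢.preT T e *
        (𝒢.preOf T _ (𝒢.φ e.1 false h))⁻¹)

/-- The normal subgroup generated by the relators. -/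
def relatorClosure : Subgroup (𝒢.PreFundamentalGroup T) :=
  Subgroup.normalClosure {x | 𝒢.IsRelator T x}

instance : (𝒢.relatorClosure T).Normal :=
  inferInstanceAs (Subgroup.normalClosure _).Normal

/-- The fundamental group `π₁(𝒢(Γ), T)` of the graph of groups with respect to the maximal
tree `T`. -/
abbrev FundamentalGroup : Type (max u v w) :=
  𝒢.PreFundamentalGroup T ⧸ 𝒢.relatorClosure T

/-- The canonical homomorphism of a vertex group to the fundamental group. -/
def of (x : Γ.vertexSet) : 𝒢.vertexGroup x →* 𝒢.FundamentalGroup T :=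
  (QuotientGroup.mk' (𝒢.relatorClosure T)).comp (𝒢.preOf T x)

/-- The edge subgroup `H_{εe}` as a subgroup of the fundamental group. -/
def edgeSubgroupInFundamentalGroup (e : Γ.edgeSet) (ε : Bool) :
    Subgroup (𝒢.FundamentalGroup T) :=
  (𝒢.edgeSubgroup e ε).map (𝒢.of T (𝒢.endpt e ε))

end GraphOfGroups

/-!
Since `C` contains an infinite group, it is closed under countable Cartesian powers, so its members,
being periodic, have finite exponent. Therefore, if an element `f` of a group `F` acts on `H` by an
automorphism of infinite order, a homomorphism `σ` of `H ⋊ F` onto a `C`-group kills some `f ^ n`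
with `n > 0`, and hence every commutator `[f ^ n, h]` with `h` in `H`, one of which is non-trivial.

This is realized by letting all edge groups be `H` and all vertex groups `H ⋊ Z`, with some of the
edge embeddings twisted by automorphisms of `H`: then `π₁` is `H ⋊ F`, where `F` is the free product
of a copy of `Z` for each vertex and a free group, and `F` acts on `H` through a homomorphism to
`D = Z * Z`. Free products of residually `C`-groups are residually `C`-groups, as one sees by
lifting homomorphisms to wreath products, so `F` and `D` are residually `C`-groups. For a countable
`D`, the product `H` of the powers `Z ^ (D ⧸ N)` over countably many normal subgroups `N` with
`D ⧸ N` in `C` and trivial intersection is a `C`-group on which `D` acts faithfully, and `H ⋊ D` is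
approximated by the `C`-groups `Z ^ (D ⧸ N) ⋊ D ⧸ N`.
-/

namespace IsRootClass

variable {C : ∀ (G : Type u) [Group G], Prop}

theorem of_injective (hC : IsRootClass C) {G H : Type u} [Group G] [Group H] (f : G →* H)
    (hf : Function.Injective f) (hH : C H) : C G :=
  hC.of_mulEquiv _ _ (MonoidHom.ofInjective hf).symm (hC.subgroup H hH f.range)

theorem of_ker (hC : IsRootClass C) {G H : Type u} [Group G] [Group H] (f : G →* H)
    (hker : C f.ker) (hH : C H) : C G :=
  hC.extension G f.ker hker
    (hC.of_mulEquiv _ _ (QuotientGroup.quotientKerEquivRange f).symm (hC.subgroup H hH f.range))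

theorem semidirectProduct (hC : IsRootClass C) {N K : Type u} [Group N] [Group K]
    (φ : K →* MulAut N) (hN : C N) (hK : C K) : C (N ⋊[φ] K) := by
  refine hC.of_ker SemidirectProduct.rightHom ?_ hK
  rw [← SemidirectProduct.range_inl_eq_ker_rightHom]
  exact hC.of_mulEquiv _ _ (MonoidHom.ofInjective SemidirectProduct.inl_injective) hN

theorem prod (hC : IsRootClass C) {N K : Type u} [Group N] [Group K] (hN : C N) (hK : C K) :
    C (N × K) :=
  hC.of_mulEquiv _ _ SemidirectProduct.mulEquivProd (hC.semidirectProduct 1 hN hK)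

theorem exists_countable_nontrivial (hC : IsRootClass C) :
    ∃ (Z : Type u) (_ : Group Z), C Z ∧ Countable Z ∧ Nontrivial Z := by
  obtain ⟨X, _, hX, _⟩ := hC.exists_nontrivial
  obtain ⟨x, hx⟩ := exists_ne (1 : X)
  exact ⟨Subgroup.zpowers x, inferInstance, hC.subgroup X hX _,
    (Subgroup.coe_zpowers x ▸ Set.countable_range _ : Set.Countable _).to_subtype,
    (Subgroup.nontrivial_iff_ne_bot _).2 (Subgroup.zpowers_ne_bot.2 hx)⟩

theorem pi_of_countable (hC : IsRootClass C) {X Y : Type u} [Group X] [Group Y] (hX : C X)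
    (hY : C Y) [Infinite Y] (Ω : Type u) [Countable Ω] : C (Ω → X) := by
  obtain ⟨i⟩ : Nonempty (Ω ↪ Y) := by
    obtain ⟨f, hf⟩ := exists_injective_nat Ω
    exact ⟨(⟨f, hf⟩ : Ω ↪ ℕ).trans (Infinite.natEmbedding Y)⟩
  refine hC.of_injective (Function.ExtendByOne.hom X i) (fun f g h => ?_) (hC.power X Y hX hY)
  funext ω
  simpa only [Function.ExtendByOne.hom_apply, i.injective.extend_apply] using congrFun h (i ω)

/-- In a group of infinite exponent, elements of unbounded order assemble to an element of infinite
order in a Cartesian power. -/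
theorem exponentExists (hC : IsRootClass C)
    (hperiodic : ∀ (G : Type u) [Group G], C G → IsMulTorsion G)
    {Y : Type u} [Group Y] [Infinite Y] (hY : C Y) {Q : Type u} [Group Q] (hQ : C Q) :
    Monoid.ExponentExists Q := by
  by_contra hne
  simp only [Monoid.ExponentExists, not_exists, not_and, not_forall] at hne
  choose q hq using fun n : ℕ => hne n.factorial n.factorial_pos
  let i := Infinite.natEmbedding Y
  obtain ⟨m, hm, hpow⟩ := isOfFinOrder_iff_pow_eq_one.1
    (hperiodic (Y → Q) (hC.power Q Y hQ hY) (Function.extend i q 1))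
  have hqm : q m ^ m = 1 := by
    simpa only [Pi.pow_apply, i.injective.extend_apply, Pi.one_apply] using congrFun hpow (i m)
  obtain ⟨c, hc⟩ := Nat.dvd_factorial hm le_rfl
  exact hq m (by rw [hc, pow_mul, hqm, one_pow])

end IsRootClass

namespace IsResidually

variable {C : ∀ (G : Type u) [Group G], Prop}

theorem of_forall_exists_ne_one (hC : IsRootClass C) {X : Type v} [Group X]
    (h : ∀ x : X, x ≠ 1 → ∃ (Q : Type u) (_ : Group Q) (σ : X →* Q), C Q ∧ σ x ≠ 1) :
    IsResidually C X := fun x hx => by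
  obtain ⟨Q, _, σ, hQ, hσ⟩ := h x hx
  exact ⟨σ.range, inferInstance, σ.rangeRestrict, hC.subgroup Q hQ _,
    σ.rangeRestrict_surjective, fun h => hσ (congrArg Subtype.val h)⟩

theorem of_mem {X : Type u} [Group X] (hX : C X) : IsResidually C X :=
  fun _ hx => ⟨X, inferInstance, MonoidHom.id X, hX, Function.surjective_id, hx⟩

theorem of_injective (hC : IsRootClass C) {X : Type v} {Y : Type w} [Group X] [Group Y]
    (f : X →* Y) (hf : Function.Injective f) (hY : IsResidually C Y) : IsResidually C X :=
  of_forall_exists_ne_one hC fun x hx => by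
    obtain ⟨Q, _, σ, hQ, -, hσ⟩ := hY (f x) ((map_ne_one_iff f hf).2 hx)
    exact ⟨Q, inferInstance, σ.comp f, hQ, hσ⟩

end IsResidually

namespace FreeProduct

open Monoid SemidirectProduct

variable {ι : Type v} {G : ι → Type w} [∀ i, Group (G i)]

/-- The element of the free product spelled by a list of letters. -/
def eval (l : List (Σ i, G i)) : CoprodI G :=
  (l.map fun g => CoprodI.of g.2).prod

theorem eval_cons (g : Σ i, G i) (l : List (Σ i, G i)) :
    eval (g :: l) = CoprodI.of g.2 * eval l :=
  List.prod_cons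

theorem eval_append_singleton (l : List (Σ i, G i)) (g : Σ i, G i) :
    eval (l ++ [g]) = eval l * CoprodI.of g.2 := by
  simp [eval]

/-- The homomorphism `φ` does not kill any non-empty initial segment of the word `l`. This is the
strengthening of `φ (eval l) ≠ 1` that passes through an induction on the length. -/
def PrefixesSurvive {K : Type*} [Group K] (φ : CoprodI G →* K) (l : List (Σ i, G i)) : Prop :=
  ∀ u, u ≠ [] → u <+: l → φ (eval u) ≠ 1

theorem PrefixesSurvive.of_prefix {K : Type*} [Group K] {φ : CoprodI G →* K}
    {l u : List (Σ i, G i)} (h : PrefixesSurvive φ l) (hu : u <+: l) : PrefixesSurvive φ u :=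
  fun v hv hvu => h v hv (hvu.trans hu)

section Twist

variable [DecidableEq ι] {K Z : Type*} [Group K] [Group Z] (φ : CoprodI G →* K)

/-- The lift of `φ` to the wreath product of `Z` and `K` whose restriction to the `i`-th factor is
conjugated by the element `f` of the base group. -/
def twist (i : ι) (f : K → Z) : CoprodI G →* (K → Z) ⋊[mulAutArrow] K :=
  CoprodI.lift fun j =>
    (MulAut.conj (if j = i then inl f else 1)).toMonoidHom.comp (inr.comp (φ.comp CoprodI.of))

variable {φ} (i : ι) (f : K → Z)

theorem twist_right (x : CoprodI G) : (twist φ i f x).right = φ x := by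
  have : rightHom.comp (twist φ i f) = φ := by
    ext j g
    by_cases hj : j = i <;> simp [twist, hj]
  exact DFunLike.congr_fun this x

theorem twist_mul_left_apply (x y : CoprodI G) (q : K) :
    (twist φ i f (x * y)).left q = (twist φ i f x).left q * (twist φ i f y).left ((φ x)⁻¹ * q) := by
  rw [map_mul, mul_left, Pi.mul_apply, twist_right]
  rfl

theorem twist_of_left_apply (g : G i) (q : K) :
    (twist φ i f (CoprodI.of g)).left q = f q * (f ((φ (CoprodI.of g))⁻¹ * q))⁻¹ := by
  have hshift (k : K) : (mulAutArrow k f : K → Z) q = f (k⁻¹ * q) := rfl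
  simp [twist, -mulAutArrow_apply_apply, hshift]

theorem twist_of_left_of_ne {j : ι} (hj : j ≠ i) (g : G j) :
    (twist φ i f (CoprodI.of g)).left = 1 := by
  simp [twist, hj]

theorem twist_eval_left_one {f : K → Z} (hf : ∀ q, q ≠ 1 → f q = 1) (l : List (Σ i, G i))
    (hl : ∀ g ∈ l.head?, g.1 ≠ i) (hφ : PrefixesSurvive φ l) :
    (twist φ i f (eval l)).left 1 = 1 := by
  induction l using List.reverseRecOn with
  | nil => simp [eval]
  | append_singleton u g ih =>
    have hu : (twist φ i f (eval u)).left 1 = 1 :=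
      ih (fun g hg => hl g (by cases u <;> simp_all)) (hφ.of_prefix (List.prefix_append _ _))
    rw [eval_append_singleton, twist_mul_left_apply, hu, one_mul]
    obtain ⟨j, g⟩ := g
    by_cases hj : j = i
    · subst hj
      have hu0 : u ≠ [] := by
        rintro rfl
        exact hl ⟨j, g⟩ rfl rfl
      have h₁ : (φ (eval u))⁻¹ * 1 ≠ 1 := by
        simpa using hφ u hu0 (List.prefix_append _ _)
      have h₂ : (φ (CoprodI.of g))⁻¹ * ((φ (eval u))⁻¹ * 1) ≠ 1 := by
        have := hφ _ (by simp) List.prefix_rfl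
        rwa [eval_append_singleton, map_mul, ← inv_ne_one, mul_inv_rev, ← mul_one (_ * _),
          mul_assoc] at this
      rw [twist_of_left_apply, hf _ h₁, hf _ h₂, inv_one, one_mul]
    · rw [twist_of_left_of_ne i f hj, Pi.one_apply]

-- At `φ g`, the base component of the image of `g :: v` is `(f 1)⁻¹`: the letter `g` contributes
-- `f (φ g) * (f 1)⁻¹` and `v` contributes nothing.
theorem prefixesSurvive_twist_cons {f : K → Z} (hf₁ : f 1 ≠ 1) (hf : ∀ q, q ≠ 1 → f q = 1)
    {g : Σ i, G i} {l : List (Σ i, G i)} (hl : ∀ g' ∈ l.head?, g'.1 ≠ g.1)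
    (hg : φ (CoprodI.of g.2) ≠ 1) (hφ : PrefixesSurvive φ l) :
    PrefixesSurvive (twist φ g.1 f) (g :: l) := by
  intro u hu hul h1
  obtain ⟨v, rfl, hvl⟩ : ∃ v, u = g :: v ∧ v <+: l := by
    cases u with
    | nil => exact absurd rfl hu
    | cons g' v =>
      obtain ⟨rfl, hv⟩ := List.cons_prefix_cons.1 hul
      exact ⟨v, rfl, hv⟩
  have hv : (twist φ g.1 f (eval v)).left 1 = 1 :=
    twist_eval_left_one g.1 hf v (fun g' hg' => hl g' (by
      obtain ⟨t, rfl⟩ := hvl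
      cases v <;> simp_all)) (hφ.of_prefix hvl)
  have h2 := congrFun (congrArg SemidirectProduct.left h1) (φ (CoprodI.of g.2))
  rw [eval_cons, twist_mul_left_apply, inv_mul_cancel, hv, twist_of_left_apply, inv_mul_cancel,
    hf _ hg, mul_one, one_mul] at h2
  exact hf₁ (inv_eq_one.1 h2)

end Twist

variable {C : ∀ (G : Type u) [Group G], Prop}

theorem exists_prefixesSurvive (hC : IsRootClass C) (hG : ∀ i, IsResidually C (G i))
    (l : List (Σ i, G i)) (hl : ∀ g ∈ l, g.2 ≠ 1) (hchain : l.IsChain fun g g' => g.1 ≠ g'.1) :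
    ∃ (K : Type u) (_ : Group K) (φ : CoprodI G →* K), C K ∧ PrefixesSurvive φ l := by
  classical
  obtain ⟨Z, _, hZ, _⟩ := hC.exists_nontrivial
  obtain ⟨z, hz⟩ := exists_ne (1 : Z)
  induction l with
  | nil => exact ⟨Z, inferInstance, 1, hZ, fun u hu h => absurd (List.prefix_nil.1 h) hu⟩
  | cons g l ih =>
    obtain ⟨K, _, φ, hK, hφ⟩ := ih (fun g' h => hl g' (.tail _ h)) hchain.tail
    obtain ⟨L, _, σ, hL, -, hσ⟩ := hG g.1 g.2 (hl g (.head _))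
    let ψ : CoprodI G →* K × L := φ.prod (CoprodI.lift (Function.update (fun j => 1) g.1 σ))
    have hψg : ψ (CoprodI.of g.2) ≠ 1 := fun h => hσ (by simpa [ψ] using congrArg Prod.snd h)
    have hψl : PrefixesSurvive ψ l := fun u hu hul h => hφ u hu hul (congrArg Prod.fst h)
    refine ⟨_, inferInstance, twist ψ g.1 (Pi.mulSingle 1 z),
      hC.semidirectProduct _ (hC.power _ _ hZ (hC.prod hK hL)) (hC.prod hK hL),
      prefixesSurvive_twist_cons (by simpa using hz) (fun q hq => Pi.mulSingle_eq_of_ne hq _)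
        (fun g' hg' h => ?_) hψg hψl⟩
    cases l with
    | nil => simp at hg'
    | cons a l =>
      obtain rfl : a = g' := by simpa using hg'
      exact (List.isChain_cons_cons.1 hchain).1 h.symm

end FreeProduct

namespace IsResidually

open Monoid

variable {C : ∀ (G : Type u) [Group G], Prop}

theorem coprodI (hC : IsRootClass C) {ι : Type v} {G : ι → Type w} [∀ i, Group (G i)]
    (hG : ∀ i, IsResidually C (G i)) : IsResidually C (CoprodI G) := by
  classical
  refine of_forall_exists_ne_one hC fun x hx => ?_
  obtain ⟨w, rfl⟩ := CoprodI.Word.equiv.symm.surjective x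
  obtain ⟨K, _, φ, hK, hφ⟩ :=
    FreeProduct.exists_prefixesSurvive hC hG w.toList w.ne_one w.chain_ne
  refine ⟨K, inferInstance, φ, hK, hφ w.toList (fun h => hx ?_) List.prefix_rfl⟩
  change (w.toList.map _).prod = 1
  rw [h, List.map_nil, List.prod_nil]

theorem prod (hC : IsRootClass C) {M : Type v} {N : Type w} [Group M] [Group N]
    (hM : IsResidually C M) (hN : IsResidually C N) : IsResidually C (M × N) :=
  of_forall_exists_ne_one hC fun x hx => by
    by_cases h : x.1 = 1
    · obtain ⟨Q, _, σ, hQ, -, hσ⟩ := hN x.2 fun h' => hx (Prod.ext h h')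
      exact ⟨Q, inferInstance, σ.comp (MonoidHom.snd M N), hQ, hσ⟩
    · obtain ⟨Q, _, σ, hQ, -, hσ⟩ := hM x.1 h
      exact ⟨Q, inferInstance, σ.comp (MonoidHom.fst M N), hQ, hσ⟩

theorem coprod (hC : IsRootClass C) {M : Type v} {N : Type w} [Group M] [Group N]
    (hM : IsResidually C M) (hN : IsResidually C N) : IsResidually C (Coprod M N) := by
  let f : Coprod M N →* CoprodI fun _ : Bool => M × N := Coprod.lift
    ((CoprodI.of (i := true)).comp (MonoidHom.inl M N))
    ((CoprodI.of (i := false)).comp (MonoidHom.inr M N))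
  let g : (CoprodI fun _ : Bool => M × N) →* Coprod M N := CoprodI.lift fun b =>
    bif b then Coprod.inl.comp (MonoidHom.fst M N) else Coprod.inr.comp (MonoidHom.snd M N)
  have hgf : g.comp f = MonoidHom.id _ := by
    ext x <;> simp [f, g]
  exact of_injective hC f (Function.LeftInverse.injective (DFunLike.congr_fun hgf))
    (coprodI hC fun _ => prod hC hM hN)

end IsResidually

namespace FreeProduct

open Monoid

variable {ι : Type v} {G : ι → Type w} [∀ i, Group (G i)]

instance [Countable ι] [∀ i, Countable (G i)] : Countable (CoprodI G) := by
  classical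
  have : Function.Injective (CoprodI.Word.toList (M := G)) := fun _ _ => CoprodI.Word.ext
  exact (this.comp CoprodI.Word.equiv.injective).countable

theorem not_isOfFinOrder_mul {i j : ι} (hij : i ≠ j) {x : G i} {y : G j} (hx : x ≠ 1)
    (hy : y ≠ 1) : ¬ IsOfFinOrder (CoprodI.of x * CoprodI.of y : CoprodI G) := by
  classical
  let w : CoprodI.NeWord G i j := .append (.singleton x hx) hij (.singleton y hy)
  have hw : ∀ n : ℕ, ∃ w' : CoprodI.NeWord G i j,
      w'.prod = (CoprodI.of x * CoprodI.of y : CoprodI G) ^ (n + 1) := by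
    intro n
    induction n with
    | zero => exact ⟨w, by simp [w, CoprodI.NeWord.append_prod]⟩
    | succ n ih =>
      obtain ⟨w', hw'⟩ := ih
      exact ⟨w'.append hij.symm w, by simp [w, CoprodI.NeWord.append_prod, hw', pow_succ]⟩
  rw [isOfFinOrder_iff_pow_eq_one]
  rintro ⟨n, hn, hpow⟩
  obtain ⟨w', hw'⟩ := hw (n - 1)
  rw [Nat.sub_add_cancel hn, hpow] at hw'
  have hempty : w'.toWord = CoprodI.Word.empty := CoprodI.Word.equiv.symm.injective hw'
  exact w'.toList_ne_nil (congrArg CoprodI.Word.toList hempty)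

/-- The product `z₁ z₂` of the two copies of `z` in the free product of two copies of a group. It
serves as an element of infinite order. -/
def mulCopies {Z : Type*} [Group Z] (z : Z) : CoprodI fun _ : Bool => Z :=
  CoprodI.of (i := true) z * CoprodI.of (i := false) z

theorem not_isOfFinOrder_mulCopies {Z : Type*} [Group Z] {z : Z} (hz : z ≠ 1) :
    ¬ IsOfFinOrder (mulCopies z) :=
  not_isOfFinOrder_mul (G := fun _ : Bool => Z) (by decide) hz hz

end FreeProduct

namespace IsResidually

open Monoid SemidirectProduct

variable {C : ∀ (G : Type u) [Group G], Prop}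

theorem freeGroup (hC : IsRootClass C) (S : Type v) : IsResidually C (FreeGroup S) := by
  obtain ⟨Z, _, hZ, _⟩ := hC.exists_nontrivial
  obtain ⟨z, hz⟩ := exists_ne (1 : Z)
  have hd : Function.Injective (zpowersHom _ (FreeProduct.mulCopies z)) :=
    injective_zpow_iff_not_isOfFinOrder.2 (FreeProduct.not_isOfFinOrder_mulCopies hz)
  have hint : IsResidually C (Multiplicative ℤ) :=
    of_injective hC _ hd (coprodI hC fun _ => of_mem hZ)
  have hunit : IsResidually C (FreeGroup Unit) :=
    of_injective hC FreeGroup.mulEquivIntOfUnique.toMonoidHom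
      FreeGroup.mulEquivIntOfUnique.injective hint
  exact of_injective hC freeGroupEquivCoprodI.toMonoidHom freeGroupEquivCoprodI.injective
    (coprodI hC fun _ => hunit)

theorem semidirectProduct (hC : IsRootClass C) {N : Type v} {F : Type w} [Group N] [Group F]
    {φ : F →* MulAut N} (hF : IsResidually C F)
    (hN : ∀ n : N, n ≠ 1 →
      ∃ (Q : Type u) (_ : Group Q) (σ : N ⋊[φ] F →* Q), C Q ∧ σ (inl n) ≠ 1) :
    IsResidually C (N ⋊[φ] F) :=
  of_forall_exists_ne_one hC fun x hx => by
    by_cases hr : x.right = 1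
    · have hl : inl x.left = x := by
        conv_rhs => rw [← inl_left_mul_inr_right x, hr, map_one, mul_one]
      exact hl ▸ hN x.left fun h => hx (SemidirectProduct.ext h hr)
    · obtain ⟨Q, _, σ, hQ, -, hσ⟩ := hF x.right hr
      exact ⟨Q, inferInstance, σ.comp rightHom, hQ, hσ⟩

theorem semidirectProduct_comp (hC : IsRootClass C) {N : Type v} {D : Type*} {F : Type w}
    [Group N] [Group D] [Group F] {φ : D →* MulAut N} (π : F →* D) (hF : IsResidually C F)
    (hD : IsResidually C (N ⋊[φ] D)) : IsResidually C (N ⋊[φ.comp π] F) :=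
  semidirectProduct hC hF fun n hn => by
    obtain ⟨Q, _, σ, hQ, -, hσ⟩ := hD (inl n) ((map_ne_one_iff _ inl_injective).2 hn)
    exact ⟨Q, inferInstance, σ.comp (map (MonoidHom.id N) π fun _ => rfl), hQ, by simpa using hσ⟩

theorem exists_normal (hC : IsRootClass C) {D : Type u} [Group D] (hD : IsResidually C D) {d : D}
    (hd : d ≠ 1) : ∃ (N : Subgroup D) (_ : N.Normal), C (D ⧸ N) ∧ d ∉ N := by
  obtain ⟨Q, _, σ, hQ, hσ, hd⟩ := hD d hd
  exact ⟨σ.ker, inferInstance,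
    hC.of_mulEquiv _ _ (QuotientGroup.quotientKerEquivOfSurjective σ hσ).symm hQ, hd⟩

theorem sigma_quotient_semidirectProduct (hC : IsRootClass C) {D Z : Type u} [Group D] [Group Z]
    {ι : Type v} (N : ι → Subgroup D) [∀ i, (N i).Normal] (hZ : C Z) (hN : ∀ i, C (D ⧸ N i))
    (hD : IsResidually C D) :
    IsResidually C (((Σ i, D ⧸ N i) → Z) ⋊[mulAutArrow] D) :=
  semidirectProduct hC hD fun f hf => by
    obtain ⟨⟨i, q⟩, hq⟩ := Function.ne_iff.1 hf
    let restrict : ((Σ i, D ⧸ N i) → Z) →* (D ⧸ N i → Z) :=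
      MonoidHom.pi fun r => Pi.evalMonoidHom _ ⟨i, r⟩
    exact ⟨(D ⧸ N i → Z) ⋊[mulAutArrow] (D ⧸ N i), inferInstance,
      map restrict (QuotientGroup.mk' (N i)) fun _ => rfl,
      hC.semidirectProduct _ (hC.power _ _ hZ (hN i)) (hN i),
      fun h => hq (congrFun (congrArg SemidirectProduct.left h) q)⟩

end IsResidually

theorem mulAutArrow_injective {G A M : Type*} [Group G] [MulAction G A] [FaithfulSMul G A]
    [Group M] [Nontrivial M] : Function.Injective (mulAutArrow : G →* MulAut (A → M)) := by
  classical
  obtain ⟨m, hm⟩ := exists_ne (1 : M)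
  refine fun g h hgh => FaithfulSMul.eq_of_smul_eq_smul fun a : A => ?_
  have hga : (Pi.mulSingle a m : A → M) (g⁻¹ • g • a) = (Pi.mulSingle a m : A → M) (h⁻¹ • g • a) :=
    congrFun (DFunLike.congr_fun hgh (Pi.mulSingle a m)) (g • a)
  rw [inv_smul_smul, Pi.mulSingle_eq_same] at hga
  by_contra hne
  rw [Pi.mulSingle_eq_of_ne (fun h' => hne (inv_smul_eq_iff.1 h'))] at hga
  exact hm hga

theorem faithfulSMul_sigma_quotient {D : Type*} [Group D] {ι : Type*} (N : ι → Subgroup D)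
    (hN : ∀ d, (∀ i, d ∈ N i) → d = 1) : FaithfulSMul D (Σ i, D ⧸ N i) where
  eq_of_smul_eq_smul {g h} hgh := by
    refine inv_mul_eq_one.1 (hN _ fun i => QuotientGroup.eq.1 ?_)
    simpa using hgh ⟨i, (1 : D)⟩

theorem IsResidually.exists_faithful_action {C : ∀ (G : Type u) [Group G], Prop}
    (hC : IsRootClass C) {Y : Type u} [Group Y] (hY : C Y) [Infinite Y] {D : Type u} [Group D]
    [Countable D] (hD : IsResidually C D) :
    ∃ (H : Type u) (_ : Group H) (φ : D →* MulAut H),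
      C H ∧ Function.Injective φ ∧ IsResidually C (H ⋊[φ] D) := by
  obtain ⟨Z, _, hZ, _⟩ := hC.exists_nontrivial
  choose N hnormal hquot hnotMem using fun d : {d : D // d ≠ 1} => hD.exists_normal hC d.2
  have : FaithfulSMul D (Σ d, D ⧸ N d) := faithfulSMul_sigma_quotient N fun d hd =>
    by_contra fun h => hnotMem ⟨d, h⟩ (hd _)
  have (d : {d : D // d ≠ 1}) : Countable (D ⧸ N d) := QuotientGroup.mk_surjective.countable
  exact ⟨(Σ d, D ⧸ N d) → Z, inferInstance, mulAutArrow, hC.pi_of_countable hZ hY _,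
    mulAutArrow_injective, sigma_quotient_semidirectProduct hC N hZ hquot hD⟩

theorem IsRootClass.exists_mulCopies_action {C : ∀ (G : Type u) [Group G], Prop}
    (hC : IsRootClass C) {Y : Type u} [Group Y] (hY : C Y) [Infinite Y] :
    ∃ (Z : Type u) (_ : Group Z) (z : Z) (H : Type u) (_ : Group H)
      (φ : (Monoid.CoprodI fun _ : Bool => Z) →* MulAut H),
      C Z ∧ C H ∧ ¬ IsOfFinOrder (φ (FreeProduct.mulCopies z)) ∧ IsResidually C (H ⋊[φ] _) := by
  obtain ⟨Z, _, hZ, _, _⟩ := hC.exists_countable_nontrivial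
  obtain ⟨z, hz⟩ := exists_ne (1 : Z)
  obtain ⟨H, _, φ, hH, hφ, hres⟩ :=
    IsResidually.exists_faithful_action hC hY (.coprodI hC fun _ : Bool => .of_mem hZ)
  exact ⟨Z, inferInstance, z, H, inferInstance, φ, hZ, hH,
    hφ.isOfFinOrder_iff.not.2 (FreeProduct.not_isOfFinOrder_mulCopies hz), hres⟩

namespace GraphOfGroups

variable {α : Type v} {β : Type w} {Γ : Graph α β}

section FundamentalGroup

variable (𝒢 : GraphOfGroups.{u} Γ) (T : Graph α β)

theorem edgeSubgroup_ne_bot (e : Γ.edgeSet) (ε : Bool) (h : Nontrivial (𝒢.edgeGroup e)) :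
    𝒢.edgeSubgroup e ε ≠ ⊥ := by
  obtain ⟨x, hx⟩ := exists_ne (1 : 𝒢.edgeGroup e)
  intro hbot
  have hmem : 𝒢.φ e ε x ∈ 𝒢.edgeSubgroup e ε := ⟨x, rfl⟩
  rw [hbot, Subgroup.mem_bot] at hmem
  exact hx (𝒢.φ_injective e ε (hmem.trans (map_one _).symm))

/-- The element `t_e` of the fundamental group. -/
def stableLetter (e : StableEdge Γ T) : 𝒢.FundamentalGroup T :=
  QuotientGroup.mk' (𝒢.relatorClosure T) (𝒢.preT T e)

theorem of_φ_eq (e : Γ.edgeSet) (he : (e : β) ∈ T.edgeSet) (h : 𝒢.edgeGroup e) :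
    𝒢.of T _ (𝒢.φ e true h) = 𝒢.of T _ (𝒢.φ e false h) := by
  rw [← mul_inv_eq_one, of, of, MonoidHom.comp_apply, MonoidHom.comp_apply, ← map_inv, ← map_mul]
  exact (QuotientGroup.eq_one_iff _).2 (Subgroup.subset_normalClosure (IsRelator.tree e he h))

theorem stableLetter_conj (e : StableEdge Γ T) (h : 𝒢.edgeGroup e.1) :
    (𝒢.stableLetter T e)⁻¹ * 𝒢.of T _ (𝒢.φ e.1 true h) * 𝒢.stableLetter T e =
      𝒢.of T _ (𝒢.φ e.1 false h) := by
  rw [← mul_inv_eq_one, of, of, stableLetter, MonoidHom.comp_apply, MonoidHom.comp_apply,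
    ← map_inv, ← map_inv, ← map_mul, ← map_mul, ← map_mul]
  exact (QuotientGroup.eq_one_iff _).2 (Subgroup.subset_normalClosure (IsRelator.stable e h))

variable {T} in
/-- The universal property of the fundamental group. -/
def lift {K : Type*} [Group K] (f : ∀ x, 𝒢.vertexGroup x →* K) (t : StableEdge Γ T → K)
    (htree : ∀ (e : Γ.edgeSet), (e : β) ∈ T.edgeSet → ∀ h : 𝒢.edgeGroup e,
      f _ (𝒢.φ e true h) = f _ (𝒢.φ e false h))
    (hstable : ∀ (e : StableEdge Γ T) (h : 𝒢.edgeGroup e.1),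
      (t e)⁻¹ * f _ (𝒢.φ e.1 true h) * t e = f _ (𝒢.φ e.1 false h)) :
    𝒢.FundamentalGroup T →* K :=
  QuotientGroup.lift _ (Monoid.Coprod.lift (Monoid.CoprodI.lift f) (FreeGroup.lift t)) <| by
    refine Subgroup.normalClosure_le_normal (N := MonoidHom.ker _) ?_
    rintro _ (⟨e, he, h⟩ | ⟨e, h⟩)
    · simp [preOf, htree e he h]
    · simp [preOf, preT, hstable e h]

section Lift

variable {T} {K : Type*} [Group K] (f : ∀ x, 𝒢.vertexGroup x →* K) (t : StableEdge Γ T → K)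
    (htree : ∀ (e : Γ.edgeSet), (e : β) ∈ T.edgeSet → ∀ h : 𝒢.edgeGroup e,
      f _ (𝒢.φ e true h) = f _ (𝒢.φ e false h))
    (hstable : ∀ (e : StableEdge Γ T) (h : 𝒢.edgeGroup e.1),
      (t e)⁻¹ * f _ (𝒢.φ e.1 true h) * t e = f _ (𝒢.φ e.1 false h))

theorem lift_of (x : Γ.vertexSet) (g : 𝒢.vertexGroup x) :
    𝒢.lift f t htree hstable (𝒢.of T x g) = f x g := by
  change Monoid.Coprod.lift (Monoid.CoprodI.lift f) (FreeGroup.lift t) (𝒢.preOf T x g) = _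
  simp [preOf]

theorem lift_stableLetter (e : StableEdge Γ T) :
    𝒢.lift f t htree hstable (𝒢.stableLetter T e) = t e := by
  change Monoid.Coprod.lift (Monoid.CoprodI.lift f) (FreeGroup.lift t) (𝒢.preT T e) = _
  simp [preT]

end Lift

theorem hom_ext {T} {K : Type*} [Group K] {f g : 𝒢.FundamentalGroup T →* K}
    (hof : ∀ x, f.comp (𝒢.of T x) = g.comp (𝒢.of T x))
    (ht : ∀ e, f (𝒢.stableLetter T e) = g (𝒢.stableLetter T e)) : f = g :=
  QuotientGroup.monoidHom_ext _ <| Monoid.Coprod.hom_ext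
    (Monoid.CoprodI.ext_hom _ _ hof) (FreeGroup.ext_hom _ _ ht)

end FundamentalGroup

section Semidirect

open Monoid SemidirectProduct

variable {H : Type u} [Group H] {A : Γ.vertexSet → Type u} [∀ x, Group (A x)]
  (o : Γ.edgeSet → Bool → Γ.vertexSet) (ho : ∀ e : Γ.edgeSet, Γ.IsLink e (o e true) (o e false))
  (a : ∀ x, A x →* MulAut H) (c : Γ.edgeSet → MulAut H) (T : Graph α β)

/-- The graph of groups with the vertex groups `H ⋊ A x` and the edge groups `H`. The embedding of
`H` at the end `e(1)` of an edge `e` is twisted by the automorphism `c e`. -/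
def semidirect : GraphOfGroups.{u} Γ where
  vertexGroup x := H ⋊[a x] A x
  endpt := o
  isLink_endpt := ho
  edgeGroup _ := H
  φ e ε := inl.comp (if ε then c e else 1).toMonoidHom
  φ_injective _ _ := inl_injective.comp (MulEquiv.injective _)

/-- The free product of the groups `A x` and the free group on the edges outside `T`; it is a
complement of `H` in the fundamental group of `semidirect`. -/
abbrev Complement (A : Γ.vertexSet → Type u) [∀ x, Group (A x)] (T : Graph α β) :
    Type (max u v w) :=
  Coprod (CoprodI A) (FreeGroup (StableEdge Γ T))

/-- The homomorphism given by `a` on the groups `A x` and by `c` on the edges outside `T`. -/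
def monodromy {K : Type*} [Group K] (a : ∀ x, A x →* K) (c : Γ.edgeSet → K) (T : Graph α β) :
    Complement A T →* K :=
  Coprod.lift (CoprodI.lift a) (FreeGroup.lift fun e => c e.1)

theorem monodromy_comp {K L : Type*} [Group K] [Group L] (f : K →* L) (a : ∀ x, A x →* K)
    (c : Γ.edgeSet → K) :
    monodromy (fun x => f.comp (a x)) (fun e => f (c e)) T = f.comp (monodromy a c T) := by
  ext <;> simp [monodromy]

/-- The canonical homomorphism of the vertex group at `x` to the fundamental group of
`semidirect`. -/
def ofVertex (x : Γ.vertexSet) : H ⋊[a x] A x →* (semidirect o ho a c).FundamentalGroup T :=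
  (semidirect o ho a c).of T x

/-- The image of `H` in the fundamental group of `semidirect`, embedded through the vertex `x`. -/
def ofBase (x : Γ.vertexSet) : H →* (semidirect o ho a c).FundamentalGroup T :=
  (ofVertex o ho a c T x).comp inl

/-- The canonical homomorphism of the complement to the fundamental group of `semidirect`. -/
def ofComplement : Complement A T →* (semidirect o ho a c).FundamentalGroup T :=
  Coprod.lift (CoprodI.lift fun x => (ofVertex o ho a c T x).comp inr)
    (FreeGroup.lift ((semidirect o ho a c).stableLetter T))

theorem ofBase_of_mem_tree (e : Γ.edgeSet) (he : (e : β) ∈ T.edgeSet) (h : H) :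
    ofBase o ho a c T (o e true) (c e h) = ofBase o ho a c T (o e false) h :=
  (semidirect o ho a c).of_φ_eq T e he h

theorem ofBase_of_stableEdge (e : StableEdge Γ T) (h : H) :
    ofBase o ho a c T (o e.1 true) (c e.1 h) =
      (semidirect o ho a c).stableLetter T e * ofBase o ho a c T (o e.1 false) h *
        ((semidirect o ho a c).stableLetter T e)⁻¹ := by
  rw [eq_mul_inv_iff_mul_eq, ← inv_mul_eq_iff_eq_mul, ← mul_assoc]
  exact (semidirect o ho a c).stableLetter_conj T e h

/-- The evident embedding of the vertex group at `x` in the semidirect product of `H` and the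
complement. -/
def vertexToSemidirect (x : Γ.vertexSet) : H ⋊[a x] A x →* H ⋊[monodromy a c T] Complement A T :=
  SemidirectProduct.map (MonoidHom.id H) (Coprod.inl.comp CoprodI.of) fun g => by
    ext; simp [monodromy]

theorem vertexToSemidirect_inl (x : Γ.vertexSet) (h : H) :
    vertexToSemidirect a c T x (inl h) = inl h := map_inl _ _ _ h

theorem vertexToSemidirect_inr (x : Γ.vertexSet) (g : A x) :
    vertexToSemidirect a c T x (inr g) = inr (Coprod.inl (CoprodI.of g)) := map_inr _ _ _ g

theorem vertexToSemidirect_conj (e : StableEdge Γ T) (x y : Γ.vertexSet) (h : H) :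
    (inr (Coprod.inr (FreeGroup.of e)))⁻¹ * vertexToSemidirect a c T x (inl (c e.1 h)) *
      inr (Coprod.inr (FreeGroup.of e)) = vertexToSemidirect a c T y (inl h) := by
  have hc : c e.1 = monodromy a c T (Coprod.inr (FreeGroup.of e)) := by simp [monodromy]
  rw [vertexToSemidirect_inl, vertexToSemidirect_inl, hc, inl_aut]
  simp [mul_assoc]

variable {o ho a c T} in
theorem semidirect_hom_ext {K : Type*} [Group K]
    {f g : (semidirect o ho a c).FundamentalGroup T →* K}
    (hbase : ∀ x, f.comp (ofBase o ho a c T x) = g.comp (ofBase o ho a c T x))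
    (hcompl : f.comp (ofComplement o ho a c T) = g.comp (ofComplement o ho a c T)) : f = g := by
  refine hom_ext _ (fun x => ?_) (fun e => ?_)
  · refine SemidirectProduct.hom_ext (N := H) (G := A x) (φ := a x) (hbase x) ?_
    ext k
    change f (ofVertex o ho a c T x (inr k)) = g (ofVertex o ho a c T x (inr k))
    simpa [ofComplement] using DFunLike.congr_fun hcompl (Coprod.inl (CoprodI.of k))
  · simpa [ofComplement] using DFunLike.congr_fun hcompl (Coprod.inr (FreeGroup.of e))

variable {o a c T} (hc : ∀ e : Γ.edgeSet, (e : β) ∈ T.edgeSet → c e = 1)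

/-- The homomorphism of the fundamental group of `semidirect` to the semidirect product that
extends the embeddings `vertexToSemidirect`. -/
def toSemidirect :
    (semidirect o ho a c).FundamentalGroup T →* H ⋊[monodromy a c T] Complement A T :=
  (semidirect o ho a c).lift (vertexToSemidirect a c T)
    (fun e => inr (Coprod.inr (FreeGroup.of e)))
    (fun e he (h : H) => by
      change vertexToSemidirect a c T (o e true) (inl (c e h)) =
        vertexToSemidirect a c T (o e false) (inl h)
      rw [vertexToSemidirect_inl, vertexToSemidirect_inl, hc e he, MulAut.one_apply])
    (fun e h => vertexToSemidirect_conj a c T e (o e.1 true) (o e.1 false) h)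

theorem toSemidirect_ofVertex (x : Γ.vertexSet) (g : H ⋊[a x] A x) :
    toSemidirect ho hc (ofVertex o ho a c T x g) = vertexToSemidirect a c T x g :=
  (semidirect o ho a c).lift_of (vertexToSemidirect a c T) _ _ _ x g

theorem toSemidirect_comp_ofBase (x : Γ.vertexSet) :
    (toSemidirect ho hc).comp (ofBase o ho a c T x) = inl := by
  ext1 h
  exact (toSemidirect_ofVertex ho hc x (inl h)).trans (vertexToSemidirect_inl a c T x h)

theorem toSemidirect_comp_ofComplement :
    (toSemidirect ho hc).comp (ofComplement o ho a c T) = inr := by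
  refine Coprod.hom_ext (CoprodI.ext_hom _ _ fun x => ?_) (FreeGroup.ext_hom _ _ fun e => ?_)
  · ext1 g
    simp [ofComplement, toSemidirect_ofVertex, vertexToSemidirect_inr]
  · simp only [ofComplement, MonoidHom.comp_apply, Coprod.lift_apply_inr, FreeGroup.lift_apply_of]
    exact (semidirect o ho a c).lift_stableLetter (vertexToSemidirect a c T) _ _ _ e

include ho hc in
theorem ofBase_injective (x : Γ.vertexSet) : Function.Injective (ofBase o ho a c T x) :=
  .of_comp (f := toSemidirect ho hc) <| by
    rw [← MonoidHom.coe_comp, toSemidirect_comp_ofBase ho hc]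
    exact inl_injective

variable {ho} (hT : T.IsMaximalTree Γ)

include hc hT

theorem ofBase_eq_of_adj {x y : Γ.vertexSet} (hxy : T.Adj x y) :
    ofBase o ho a c T x = ofBase o ho a c T y := by
  obtain ⟨e, heT⟩ := hxy
  have heΓ : Γ.IsLink e x y := heT.mono hT.spanning.le
  let e' : Γ.edgeSet := ⟨e, heΓ.edge_mem⟩
  have hends : ofBase o ho a c T (o e' true) = ofBase o ho a c T (o e' false) := by
    ext h
    simpa [hc e' heT.edge_mem] using ofBase_of_mem_tree o ho a c T e' heT.edge_mem h
  rcases (ho e').eq_and_eq_or_eq_and_eq heΓ with ⟨h₁, h₂⟩ | ⟨h₁, h₂⟩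
  · rwa [Subtype.ext h₁, Subtype.ext h₂] at hends
  · rw [Subtype.ext h₁, Subtype.ext h₂] at hends
    exact hends.symm

theorem ofBase_eq (x y : Γ.vertexSet) : ofBase o ho a c T x = ofBase o ho a c T y := by
  have hV := hT.spanning.vertexSet_eq
  suffices ∀ x y : T.vertexSet,
      ofBase o ho a c T ⟨x, hV ▸ x.2⟩ = ofBase o ho a c T ⟨y, hV ▸ y.2⟩ from
    this ⟨x, hV.symm ▸ x.2⟩ ⟨y, hV.symm ▸ y.2⟩
  intro x y
  obtain ⟨W⟩ := hT.isTree.connected.preconnected x y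
  induction W with
  | nil => rfl
  | cons h _ ih => exact (ofBase_eq_of_adj hc hT h.2).trans ih

theorem ofBase_monodromy (x : Γ.vertexSet) (f : Complement A T) (h : H) :
    ofBase o ho a c T x (monodromy a c T f h) =
      ofComplement o ho a c T f * ofBase o ho a c T x h * (ofComplement o ho a c T f)⁻¹ := by
  induction f using Coprod.induction_on generalizing h with
  | inl f =>
    induction f using CoprodI.induction_on generalizing h with
    | one => simp
    | of y g =>
      rw [ofBase_eq hc hT x y]
      simp [monodromy, ofComplement, ofBase, inl_aut]
    | mul f g hf hg => simp [hf, hg, mul_assoc]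
  | inr f =>
    induction f using FreeGroup.induction_on generalizing h with
    | C1 => simp
    | of e =>
      have hrel := ofBase_of_stableEdge o ho a c T e h
      rw [ofBase_eq hc hT _ x, ofBase_eq hc hT (o e.1 false) x] at hrel
      simpa [monodromy, ofComplement] using hrel
    | inv_of e he =>
      have hinv := he ((monodromy a c T (Coprod.inr (FreeGroup.of e)))⁻¹ h)
      rw [MulAut.apply_inv_self] at hinv
      simp [hinv, mul_assoc]
    | mul f g hf hg => simp [hf, hg, mul_assoc]
  | mul f g hf hg => simp [hf, hg, mul_assoc]

theorem ofBase_mem_edgeSubgroup (x : Γ.vertexSet) (e : Γ.edgeSet) (ε : Bool) (h : H) :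
    ofBase o ho a c T x h ∈ (semidirect o ho a c).edgeSubgroupInFundamentalGroup T e ε := by
  rw [ofBase_eq hc hT x (o e ε)]
  refine ⟨_, ⟨(if ε then c e else 1)⁻¹ h, rfl⟩, ?_⟩
  exact congrArg (ofBase o ho a c T (o e ε)) (MulAut.apply_inv_self _ _ h)

/-- The fundamental group of `semidirect` is the semidirect product of `H`, embedded through any
vertex `x`, and the complement. -/
def fundamentalGroupEquiv (x : Γ.vertexSet) :
    (semidirect o ho a c).FundamentalGroup T ≃* H ⋊[monodromy a c T] Complement A T :=
  MonoidHom.toMulEquiv (toSemidirect ho hc)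
    (SemidirectProduct.lift (ofBase o ho a c T x) (ofComplement o ho a c T) fun f => by
      ext h
      simp [ofBase_monodromy hc hT])
    (semidirect_hom_ext
      (fun y => by
        rw [MonoidHom.comp_assoc, toSemidirect_comp_ofBase, lift_comp_inl, MonoidHom.id_comp,
          ofBase_eq hc hT x y])
      (by rw [MonoidHom.comp_assoc, toSemidirect_comp_ofComplement, lift_comp_inr,
        MonoidHom.id_comp]))
    (SemidirectProduct.hom_ext
      (by rw [MonoidHom.comp_assoc, lift_comp_inl, toSemidirect_comp_ofBase, MonoidHom.id_comp])
      (by rw [MonoidHom.comp_assoc, lift_comp_inr, toSemidirect_comp_ofComplement,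
        MonoidHom.id_comp]))

theorem ker_inf_edgeSubgroup_ne_bot {Q : Type*} [Group Q] (hQ : Monoid.ExponentExists Q)
    (σ : (semidirect o ho a c).FundamentalGroup T →* Q) {f : Complement A T}
    (hf : ¬ IsOfFinOrder (monodromy a c T f)) (e : Γ.edgeSet) (ε : Bool) :
    σ.ker ⊓ (semidirect o ho a c).edgeSubgroupInFundamentalGroup T e ε ≠ ⊥ := by
  obtain ⟨n, hn, hQn⟩ := hQ
  have hfn : monodromy a c T (f ^ n) ≠ 1 := fun h =>
    hf (isOfFinOrder_iff_pow_eq_one.2 ⟨n, hn, by rw [← map_pow, h]⟩)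
  obtain ⟨h, hh⟩ : ∃ h, monodromy a c T (f ^ n) h ≠ h := by
    by_contra! hfix
    exact hfn (MulEquiv.ext hfix)
  refine Subgroup.ne_bot_iff_exists_ne_one.2
    ⟨⟨ofBase o ho a c T (o e ε) (monodromy a c T (f ^ n) h * h⁻¹), ?_,
      ofBase_mem_edgeSubgroup hc hT _ e ε _⟩, fun hone => hh ?_⟩
  · change σ _ = 1
    rw [map_mul, ofBase_monodromy hc hT]
    simp [hQn]
  · rw [← mul_inv_eq_one]
    exact (map_eq_one_iff _ (ofBase_injective ho hc _)).1 (congrArg Subtype.val hone)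

end Semidirect

end GraphOfGroups

namespace GraphOfGroups

open Monoid FreeProduct

variable {α : Type v} {β : Type w} {Γ T : Graph α β}

theorem exists_orientation (Γ : Graph α β) :
    ∃ o : Γ.edgeSet → Bool → Γ.vertexSet, ∀ e : Γ.edgeSet, Γ.IsLink e (o e true) (o e false) := by
  choose s t hst using fun e : Γ.edgeSet => Graph.exists_isLink_of_mem_edgeSet e.2
  exact ⟨fun e ε => if ε then ⟨s e, (hst e).left_mem⟩ else ⟨t e, (hst e).right_mem⟩, hst⟩

theorem ne_of_isLink_of_mem_maximalTree (hT : T.IsMaximalTree Γ) {e : β} {x y : α}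
    (hxy : Γ.IsLink e x y) (he : e ∈ T.edgeSet) : x ≠ y := by
  have := hT.simple
  exact ((hT.spanning.le.isLink_iff he).2 hxy).ne

theorem isResidually_fundamentalGroup_semidirect {C : ∀ (G : Type u) [Group G], Prop}
    (hC : IsRootClass C) {H : Type u} [Group H] {A : Γ.vertexSet → Type u} [∀ x, Group (A x)]
    {D : Type*} [Group D] {φ : D →* MulAut H} {o : Γ.edgeSet → Bool → Γ.vertexSet}
    {ho : ∀ e : Γ.edgeSet, Γ.IsLink e (o e true) (o e false)} {a : ∀ x, A x →* D}
    {c : Γ.edgeSet → D} (hc : ∀ e : Γ.edgeSet, (e : β) ∈ T.edgeSet → c e = 1)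
    (hT : T.IsMaximalTree Γ) (x : Γ.vertexSet) (hA : ∀ x, IsResidually C (A x))
    (hD : IsResidually C (H ⋊[φ] D)) :
    IsResidually C
      ((semidirect o ho (fun x => φ.comp (a x)) fun e => φ (c e)).FundamentalGroup T) := by
  let E := fundamentalGroupEquiv (ho := ho) (a := fun x => φ.comp (a x)) (c := fun e => φ (c e))
    (fun e he => by rw [hc e he, map_one]) hT x
  refine .of_injective hC E.toMonoidHom E.injective ?_
  rw [monodromy_comp]
  exact .semidirectProduct_comp hC _ (.coprod hC (.coprodI hC hA) (.freeGroup hC _)) hD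

section Label

variable (o : Γ.edgeSet → Bool → Γ.vertexSet) (x₀ : Γ.vertexSet) (Z : Type u) [Group Z]

open Classical in
/-- The action of the groups `A x = Z` through the free product of two copies of `Z`: the first
copy at the vertex `x₀` and the second copy at the other vertices. -/
noncomputable def vertexLabel (x : Γ.vertexSet) : Z →* CoprodI fun _ : Bool => Z :=
  CoprodI.of (M := fun _ : Bool => Z) (i := decide (x = x₀))

open Classical in
/-- The function on the edges with the value `d` on the loops and `1` on the other edges. -/
noncomputable def edgeLabel {D : Type*} [One D] (d : D) (e : Γ.edgeSet) : D :=
  if o e true = o e false then d else 1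

variable {o x₀ Z} (ho : ∀ e : Γ.edgeSet, Γ.IsLink e (o e true) (o e false))
  (hT : T.IsMaximalTree Γ)

include ho hT

theorem edgeLabel_eq_one {D : Type*} [One D] (d : D) (e : Γ.edgeSet) (he : (e : β) ∈ T.edgeSet) :
    edgeLabel o d e = 1 :=
  if_neg fun h => ne_of_isLink_of_mem_maximalTree hT (ho e) he (congrArg Subtype.val h)

theorem mulCopies_mem_range_monodromy (hedge : Γ.edgeSet.Nonempty) (z : Z) :
    mulCopies z ∈ (monodromy (vertexLabel x₀ Z) (edgeLabel o (mulCopies z)) T).range := by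
  by_cases hx : ∃ x, x ≠ x₀
  · obtain ⟨x, hx⟩ := hx
    refine ⟨Coprod.inl (CoprodI.of (i := x₀) z * CoprodI.of (i := x) z), ?_⟩
    have h₀ : vertexLabel x₀ Z x₀ z = CoprodI.of (i := true) z := by simp [vertexLabel]
    have h₁ : vertexLabel x₀ Z x z = CoprodI.of (i := false) z := by simp [vertexLabel, hx]
    simp [monodromy, h₀, h₁, mulCopies]
  · push Not at hx
    obtain ⟨e, he⟩ := hedge
    have hloop : o ⟨e, he⟩ true = o ⟨e, he⟩ false := (hx _).trans (hx _).symm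
    have heT : e ∉ T.edgeSet := fun heT =>
      ne_of_isLink_of_mem_maximalTree hT (ho ⟨e, he⟩) heT (congrArg Subtype.val hloop)
    refine ⟨Coprod.inr (FreeGroup.of ⟨⟨e, he⟩, heT⟩), ?_⟩
    simp [monodromy, edgeLabel, hloop]

end Label

end GraphOfGroups

open GraphOfGroups FreeProduct in
theorem theorem3 (C : ∀ (G : Type u) [Group G], Prop) (hC : IsRootClass C)
    (hperiodic : ∀ (G : Type u) [Group G], C G → IsMulTorsion G)
    (hinfinite : ∃ (G : Type u) (_ : Group G), C G ∧ Infinite G)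
    {α : Type v} {β : Type w} (Γ : Graph α β) (hconn : Γ.IsConnected)
    (hedge : Γ.edgeSet.Nonempty) :
    ∃ 𝒢 : GraphOfGroups.{u} Γ,
      (∀ x, C (𝒢.vertexGroup x)) ∧
      (∀ e ε, 𝒢.edgeSubgroup e ε ≠ ⊥) ∧
      (∀ T : Graph α β, T.IsMaximalTree Γ → IsResidually C (𝒢.FundamentalGroup T)) ∧
      (∀ T : Graph α β, T.IsMaximalTree Γ →
        ∀ (Q : Type u) [Group Q] (σ : 𝒢.FundamentalGroup T →* Q),
          C Q → Function.Surjective σ →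
            ∀ e ε, σ.ker ⊓ 𝒢.edgeSubgroupInFundamentalGroup T e ε ≠ ⊥) := by
  obtain ⟨Y, _, hY, _⟩ := hinfinite
  obtain ⟨x₀⟩ := hconn.nonempty
  obtain ⟨o, ho⟩ := exists_orientation Γ
  obtain ⟨Z, _, z, H, _, φ, hZ, hH, hφ, hres⟩ := hC.exists_mulCopies_action hY
  have hH_nontrivial : Nontrivial H := not_subsingleton_iff_nontrivial.1 fun _ =>
    hφ (isOfFinOrder_of_finite _)
  have hc (T : Graph α β) (hT : T.IsMaximalTree Γ) := edgeLabel_eq_one ho hT (mulCopies z)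
  refine ⟨semidirect o ho (fun x => φ.comp (vertexLabel x₀ Z x))
      fun e => φ (edgeLabel o (mulCopies z) e),
    fun x => hC.semidirectProduct _ hH hZ,
    fun e ε => edgeSubgroup_ne_bot _ e ε hH_nontrivial,
    fun T hT => isResidually_fundamentalGroup_semidirect hC (hc T hT) hT x₀
      (fun _ => .of_mem hZ) hres,
    fun T hT Q _ σ hQ _ e ε => ?_⟩
  obtain ⟨f, hf⟩ := mulCopies_mem_range_monodromy (x₀ := x₀) ho hT hedge z
  refine ker_inf_edgeSubgroup_ne_bot (fun e he => by rw [hc T hT e he, map_one]) hT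
    (hC.exponentExists hperiodic hY hQ) σ (f := f) ?_ e ε
  rwa [monodromy_comp, MonoidHom.comp_apply, hf]
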